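/- Conventions. Let $S$ be a domain with quotient field $F$, and let $K$ be a torsion-free $S$-module with divisible hull $FK=F\otimes_S K$; the rank of $K$ is $\dim_F FK$. A subring $R$ of $S$ is strongly twisted by $K$ if there is a derivation $D:F\to FK$ (an additive map with $D(xy)=xD(y)+yD(x)$) such that (a) $R=S\cap D^{-1}(K)$; (b) $D(F)$ generates $FK$ as an $F$-vector space; (c) $S\subseteq \operatorname{Ker}D+sS$ for every $0\neq s\in S$. A domain is stable if each of its ideals is projective as a module over its ring of endomorphisms. The normalization of a domain is its integral closure in its quotient field. An ideal is minimally generated by $m$ elements, $m\in\mathbb{N}$, if it can be generated by $m$ but by no fewer elements, and it is minimally generated by $\infty+1=\infty$ elements if it is not finitely generated. Proposition 7.3. Let $S$ be a Dedekind domain, not a field, with quotient field $F$ and at most countably many maximal ideals, and suppose that $S$ has a subring that is strongly twisted by a torsion-free $S$-module of infinite rank. Let $\{e_n\}_{n=1}^\infty$ be a sequence with $e_n\in\{1,2,3,\ldots\}\cup\{\infty\}$ for each $n$. Let $J=\{1,\ldots,m\}$ if $S$ has exactly $m$ maximal ideals, $m$ finite, and let $J=\{1,2,3,\ldots\}$ if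 $S$ has infinitely many. Then there exist a subring $R$ of $S$ and a listing, without repetition, $M_n$ $(n\in J)$ of all the maximal ideals of $R$ such that: 1. $R$ is a stable domain having normalization $S$ and quotient field $F$. 2. For each $n\in J$, $M_n$ is minimally generated by $e_n+1$ elements. 3. If $e_n$ is finite for each $n\in J$, then $R$ is a Noetherian domain. -/

import Mathlib

open scoped TensorProduct

/-- Let `S` be a domain with quotient field `F`, `K` an `S`-module with divisible hull
`FK = F ⊗[S] K`, and `D : F → FK` a derivation. `D` strongly twists the subring `R` of `S` by `K`
if `R = S ∩ D⁻¹(K)`, the image of `D` generates `FK` as an `F`-vector space, and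
`S ⊆ Ker D + sS` for every nonzero `s` in `S`. -/
structure StronglyTwists {S F K : Type*} [CommRing S] [Field F] [Algebra S F]
    [AddCommGroup K] [Module S K]
    (D : Derivation ℤ F (F ⊗[S] K)) (R : Subring S) : Prop where
  mem_iff : ∀ s : S, s ∈ R ↔ ∃ k : K, D (algebraMap S F s) = (1 : F) ⊗ₜ[S] k
  span_eq_top : Submodule.span F (Set.range D) = ⊤
  exists_eq_add : ∀ s : S, s ≠ 0 → ∀ t : S, ∃ x : F, D x = 0 ∧
    ∃ u : S, algebraMap S F t = x + algebraMap S F (s * u)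

/-- The subring `R` of `S` is strongly twisted by the `S`-module `K`, where `F` is the quotient
field of `S`. -/
def IsStronglyTwistedBy {S : Type*} (F : Type*) [CommRing S] [Field F] [Algebra S F]
    (R : Subring S) (K : Type*) [AddCommGroup K] [Module S K] : Prop :=
  ∃ D : Derivation ℤ F (F ⊗[S] K), StronglyTwists D R

/-- An ideal is stable if it is projective as a module over its ring of endomorphisms. -/
def IsStableIdeal {R : Type*} [CommRing R] (I : Ideal R) : Prop :=
  Module.Projective (Module.End R I) I

/-- A stable domain is a domain each of whose ideals is stable. -/
structure IsStableDomain (R : Type*) [CommRing R] : Prop where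
  isDomain : IsDomain R
  isStableIdeal : ∀ I : Ideal R, IsStableIdeal I

/-- The minimal number of generators of an ideal, with value `⊤` exactly for the ideals that are
not finitely generated. -/
noncomputable def minGenerators {R : Type*} [CommRing R] (I : Ideal R) : ℕ∞ :=
  ⨅ (s : Set R) (_ : Ideal.span s = I), s.encard

/-! Restrict the given derivation to `d : S → V`, with `V = FK`. The given lattice `K` and its
subring are then discarded: only density of the constants (the kernel of `d`), the fact that the
image of `d` spans `V`, and infinite rank matter. Let `L` be any submodule of `V` into which every
vector has a nonzero multiple. Then `R = d⁻¹(L)` is stable with quotient field `F` and normalization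
`S` (`isStableDomain`, `isFractionRing`, `isIntegralClosure`), and contraction matches the maximal
ideals of `S` with those of `R`.

The choice of `L` controls the generators. For `M = N ∩ R`, the map `x ↦ (x, d x)` sends `M ^ 2`
into `N ^ 2` and `N L`. One constant parameter accounts for `N / N ^ 2`, and since `d` maps onto `V
/ L`, each basis vector of `L / N L` accounts for one more element of `M`. Hence `M` needs `dim (L /
N L) + 1` generators (`minGenerators_comap_le`, `le_minGenerators_comap`).

To prescribe these dimensions, take a basis of `V` and let `L` require integrality at the `n`-th
maximal ideal in exactly `e n` coordinates (`coordinateLattice`). The unrestricted coordinates are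
divisible at that ideal and contribute nothing. Cohen's theorem reduces the Noetherian property to
the maximal ideals. -/

/-- The kernel of `d` is dense in `S` for the topology given by the nonzero ideals. -/
def HasDenseKernel {S V : Type*} [CommRing S] [AddCommGroup V] [Module S V]
    (d : Derivation ℤ S V) : Prop :=
  ∀ s : S, s ≠ 0 → ∀ t : S, ∃ a u : S, d a = 0 ∧ t = a + s * u

/-- The subring of elements of `S` which a derivation maps into the submodule `L`. -/
def twistedSubring {S V : Type*} [CommRing S] [AddCommGroup V] [Module S V]
    (d : Derivation ℤ S V) (L : Submodule S V) : Subring S where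
  carrier := {s | d s ∈ L}
  mul_mem' {x y} hx hy := by
    rw [Set.mem_ofPred_eq, d.leibniz]
    exact L.add_mem (L.smul_mem _ hy) (L.smul_mem _ hx)
  one_mem' := by simp
  add_mem' {x y} hx hy := by
    rw [Set.mem_ofPred_eq, map_add]
    exact L.add_mem hx hy
  zero_mem' := by simp
  neg_mem' {x} hx := by
    rw [Set.mem_ofPred_eq, map_neg]
    exact L.neg_mem hx

/-! ### Constants, and two-element dual bases for ideals of a twisted subring -/

section Twisted

variable {S V : Type*} [CommRing S] [AddCommGroup V] [Module S V]
  {d : Derivation ℤ S V} {L : Submodule S V}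

theorem mem_twistedSubring {s : S} : s ∈ twistedSubring d L ↔ d s ∈ L := Iff.rfl

theorem mem_twistedSubring_of_eq_zero {s : S} (h : d s = 0) : s ∈ twistedSubring d L := by
  rw [mem_twistedSubring, h]
  exact L.zero_mem

theorem Derivation.map_constant_mul {a : S} (ha : d a = 0) (s : S) : d (a * s) = a • d s := by
  rw [d.leibniz, ha, smul_zero, add_zero]

theorem Derivation.map_mul_constant {a : S} (ha : d a = 0) (s : S) : d (s * a) = a • d s := by
  rw [mul_comm, d.map_constant_mul ha]

/-- If an ideal of a twisted subring contains `i`, `i * s`, `i * t` and a nonzero constant, then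
it contains `i * s * t`. -/
theorem HasDenseKernel.exists_mem_eq_mul_mul [IsDomain S] [Module.IsTorsionFree S V]
    (hd : HasDenseKernel d) (I : Ideal (twistedSubring d L))
    {a i x y : twistedSubring d L} (ha : a ∈ I) (ha0 : (a : S) ≠ 0) (hda : d a = 0) (hi : i ∈ I)
    (hx : x ∈ I) (hy : y ∈ I) {s t : S} (hs : (x : S) = i * s) (ht : (y : S) = i * t) :
    ∃ w ∈ I, (w : S) = i * s * t := by
  have haa : d ((a : S) * a) = 0 := by rw [d.map_constant_mul hda, hda, smul_zero]
  -- With `s = c + a²w` and `t = e + a²v`, one has `i s t = e x + c y - c e i + a⁴ i w v`. Only the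
  -- last term is in doubt; it is `a` times `a³ i w v`, which lies in the subring because `a² i dw`
  -- and `a² i dv` lie in `L`.
  obtain ⟨c, w, hc, rfl⟩ := hd (a * a) (mul_ne_zero ha0 ha0) s
  obtain ⟨e, v, he, rfl⟩ := hd (a * a) (mul_ne_zero ha0 ha0) t
  have h1 : d i ∈ L := i.2
  have h2 : ((a : S) * a) • (i : S) • d w ∈ L := by
    have h : d x ∈ L := x.2
    rw [hs, d.leibniz, map_add, hc, zero_add, d.map_constant_mul haa] at h
    have := L.sub_mem h (L.smul_mem (c + a * a * w) h1)
    convert this using 1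
    module
  have h3 : ((a : S) * a) • (i : S) • d v ∈ L := by
    have h : d y ∈ L := y.2
    rw [ht, d.leibniz, map_add, he, zero_add, d.map_constant_mul haa] at h
    have := L.sub_mem h (L.smul_mem (e + a * a * v) h1)
    convert this using 1
    module
  have h4 : (a : S) * a * a * (i * w * v) ∈ twistedSubring d L := by
    rw [mem_twistedSubring, mul_assoc, d.map_constant_mul haa, d.map_constant_mul hda,
      d.leibniz, d.leibniz]
    have := L.add_mem (L.smul_mem (a * a * a * w * v : S) h1)
      (L.add_mem (L.smul_mem (a * v : S) h2) (L.smul_mem (a * w : S) h3))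
    convert this using 1
    module
  let c' : twistedSubring d L := ⟨c, mem_twistedSubring_of_eq_zero hc⟩
  let e' : twistedSubring d L := ⟨e, mem_twistedSubring_of_eq_zero he⟩
  refine ⟨e' * x + c' * y - c' * e' * i + ⟨_, h4⟩ * a,
    I.add_mem (I.sub_mem (I.add_mem (I.mul_mem_left _ hx) (I.mul_mem_left _ hy))
      (I.mul_mem_left _ hi)) (I.mul_mem_left _ ha), ?_⟩
  simp only [Subring.coe_add, AddSubgroupClass.coe_sub, Subring.coe_mul, hs, ht, c', e']
  ring

/-- Approximating `s` by a constant modulo `s²` gives the constant `s (1 - s u)`. It vanishes only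
if `s` is a unit, and then `1` is the required multiple. -/
theorem HasDenseKernel.exists_constant_mul [IsDomain S] (hd : HasDenseKernel d) {s : S}
    (hs : s ≠ 0) : ∃ u : S, s * u ≠ 0 ∧ d (s * u) = 0 := by
  obtain ⟨a, u, ha, hu⟩ := hd (s * s) (mul_ne_zero hs hs) s
  have h : s * (1 - s * u) = a := by linear_combination hu
  by_cases h0 : a = 0
  · have h1 : s * u = 1 := by
      have := (mul_eq_zero.1 (h.trans h0)).resolve_left hs
      linear_combination -this
    exact ⟨u, by simp [h1], by simp [h1]⟩
  · exact ⟨1 - s * u, by rwa [h], by rwa [h]⟩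

theorem HasDenseKernel.exists_constant_smul_mem [IsDomain S] (hd : HasDenseKernel d)
    (hL : ∀ v : V, ∃ s : S, s ≠ 0 ∧ s • v ∈ L) (v : V) :
    ∃ a : S, a ≠ 0 ∧ d a = 0 ∧ a • v ∈ L := by
  obtain ⟨s, hs, h⟩ := hL v
  obtain ⟨u, hu, hdu⟩ := hd.exists_constant_mul hs
  refine ⟨s * u, hu, hdu, ?_⟩
  rw [mul_comm, mul_smul]
  exact L.smul_mem _ h

/-- A nonzero ideal of a twisted subring contains a nonzero constant. -/
theorem HasDenseKernel.exists_constant_mem [IsDomain S] [Module.IsTorsionFree S V]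
    (hd : HasDenseKernel d) {I : Ideal (twistedSubring d L)} (hI : I ≠ ⊥) :
    ∃ a ∈ I, (a : S) ≠ 0 ∧ d a = 0 := by
  obtain ⟨r, hr, hr0⟩ := Submodule.exists_mem_ne_zero_of_ne_bot hI
  have hr0 : (r : S) ≠ 0 := by simpa using hr0
  obtain ⟨u, hu, hdu⟩ := hd.exists_constant_mul (mul_ne_zero hr0 hr0)
  -- The constant is `r · (r u)`. Differentiating this product gives `d (r u) = -u • d r`, so `r u`
  -- is in the subring.
  have hmem : (r : S) * u ∈ twistedSubring d L := by
    rw [mul_assoc, d.leibniz] at hdu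
    have h : d ((r : S) * u) = -(u • d r) := by
      apply smul_right_injective V hr0
      simp only
      rw [eq_neg_of_add_eq_zero_left hdu]
      module
    rw [mem_twistedSubring, h]
    exact L.neg_mem (L.smul_mem _ r.2)
  exact ⟨⟨_, hmem⟩ * r, I.mul_mem_left _ hr, by simpa [mul_comm, mul_left_comm, mul_assoc] using hu,
    by simpa [mul_comm, mul_left_comm, mul_assoc] using hdu⟩

/-- In a nonzero ideal `I` of a twisted subring of a Dedekind domain there is a nonzero `i` such
that `I S = i S + a I S`. -/
theorem HasDenseKernel.exists_span_sup_eq_map [IsDedekindDomain S]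
    (hd : HasDenseKernel d) {I : Ideal (twistedSubring d L)} {a : twistedSubring d L}
    (ha : a ∈ I) (ha0 : (a : S) ≠ 0) :
    ∃ i ∈ I, (i : S) ≠ 0 ∧ Ideal.span {(i : S)} ⊔ Ideal.span {(a : S)} *
      I.map (twistedSubring d L).subtype = I.map (twistedSubring d L).subtype := by
  set J := I.map (twistedSubring d L).subtype with hJ
  have hIJ : ∀ x ∈ I, (x : S) ∈ J := fun x hx => Ideal.mem_map_of_mem _ hx
  have hle : Ideal.span {(a : S)} * J ≤ J := Ideal.mul_le_right
  have hne : Ideal.span {(a : S)} * J ≠ 0 := by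
    refine mul_ne_zero (by simpa using ha0) fun h => ha0 ?_
    have := hIJ a ha
    rw [h] at this
    simpa using this
  -- Coefficients from `S` can be replaced by constants modulo `a`, so `I` is dense in `J = I S`
  -- modulo `a J`.
  have happrox : ∀ j ∈ J, ∃ i ∈ I, j - i ∈ Ideal.span {(a : S)} * J := by
    intro j hj
    rw [hJ, Ideal.map] at hj
    induction hj using Submodule.closure_induction with
    | zero => exact ⟨0, I.zero_mem, by simp⟩
    | add x y _ _ hx hy =>
      obtain ⟨i, hi, h⟩ := hx
      obtain ⟨k, hk, h'⟩ := hy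
      refine ⟨i + k, I.add_mem hi hk, ?_⟩
      convert Ideal.add_mem _ h h' using 1
      simp only [Subring.coe_add]
      ring
    | smul_mem s x hx =>
      obtain ⟨x, hx, rfl⟩ := hx
      obtain ⟨c, u, hc, rfl⟩ := hd a ha0 s
      refine ⟨⟨c, mem_twistedSubring_of_eq_zero hc⟩ * x, I.mul_mem_left _ hx, ?_⟩
      have : (a : S) * (u * x) ∈ Ideal.span {(a : S)} * J :=
        Ideal.mul_mem_mul (Ideal.mem_span_singleton_self _) (J.mul_mem_left _ (hIJ x hx))
      convert this using 1
      simp only [Subring.coe_mul, smul_eq_mul, Subring.subtype_apply]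
      ring
  obtain ⟨j, hj⟩ := IsDedekindDomain.exists_sup_span_eq hle hne
  have hjJ : j ∈ J := hj ▸ Ideal.mem_sup_right (Ideal.mem_span_singleton_self j)
  obtain ⟨i, hi, hij⟩ := happrox j hjJ
  have hsup : Ideal.span {(i : S)} ⊔ Ideal.span {(a : S)} * J = J := by
    refine le_antisymm (sup_le ((Ideal.span_singleton_le_iff_mem _).2 (hIJ i hi)) hle) ?_
    conv_lhs => rw [← hj]
    refine sup_le le_sup_right ((Ideal.span_singleton_le_iff_mem _).2 ?_)
    have := Ideal.add_mem _ (Ideal.mem_sup_left (Ideal.mem_span_singleton_self (i : S)))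
      (Ideal.mem_sup_right (S := Ideal.span {(i : S)}) hij)
    simpa using this
  -- If the approximation is zero then `J = a J`, and `a` itself serves.
  by_cases hi0 : (i : S) = 0
  · refine ⟨a, ha, ha0, le_antisymm (sup_le ((Ideal.span_singleton_le_iff_mem _).2 (hIJ a ha)) hle)
      (le_trans (le_of_eq ?_) le_sup_right)⟩
    rw [hi0] at hsup
    simpa using hsup.symm
  · exact ⟨i, hi, hi0, hsup⟩

/-- A dual basis, with two elements, of a nonzero ideal of a twisted subring. -/
theorem HasDenseKernel.exists_dual_basis [IsDedekindDomain S] [Module.IsTorsionFree S V]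
    {F : Type*} [Field F] [Algebra S F] [FaithfulSMul S F]
    (hd : HasDenseKernel d) {I : Ideal (twistedSubring d L)} (hI : I ≠ ⊥) :
    ∃ i ∈ I, ∃ a ∈ I, ∃ z w : F, z * algebraMap S F i + w * algebraMap S F a = 1 ∧
      ∀ x ∈ I, ∀ y ∈ I, (∃ r ∈ I, algebraMap S F r = z * algebraMap S F x * algebraMap S F y) ∧
        (∃ r ∈ I, algebraMap S F r = w * algebraMap S F x * algebraMap S F y) := by
  obtain ⟨a, ha, ha0, hda⟩ := hd.exists_constant_mem hI
  obtain ⟨i, hi, hi0, hsup⟩ := hd.exists_span_sup_eq_map ha ha0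
  set J := I.map (twistedSubring d L).subtype with hJ
  have hIJ : ∀ x ∈ I, (x : S) ∈ J := fun x hx => Ideal.mem_map_of_mem _ hx
  have hJ0 : J ≠ 0 := fun h => by
    have := hIJ a ha
    rw [h] at this
    exact ha0 (by simpa using this)
  -- `H = i J⁻¹` is coprime to `a`. This yields constants `e ∈ H` and `f` with `e + a f = 1`, and `e
  -- x / i ∈ S` for `x ∈ I`.
  obtain ⟨H, hH⟩ : J ∣ Ideal.span {(i : S)} :=
    Ideal.dvd_iff_le.2 ((Ideal.span_singleton_le_iff_mem _).2 (hIJ i hi))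
  have htop : H ⊔ Ideal.span {(a : S)} = ⊤ := by
    have : J * (H ⊔ Ideal.span {(a : S)}) = J * ⊤ := by
      rw [Ideal.mul_sup, ← hH, mul_comm J (Ideal.span _), hsup, Ideal.mul_top]
    exact mul_left_cancel₀ hJ0 this
  have hiH : (i : S) ∈ H := by
    have : (i : S) ∈ J * H := hH ▸ Ideal.mem_span_singleton_self _
    exact Ideal.mul_le_right this
  obtain ⟨h, hh, k, hk, hhk⟩ := Submodule.mem_sup.1 ((Ideal.eq_top_iff_one _).1 htop)
  obtain ⟨u, rfl⟩ := Ideal.mem_span_singleton'.1 hk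
  obtain ⟨e, v, he, hev⟩ := hd (a * i) (mul_ne_zero ha0 hi0) h
  have heH : e ∈ H := by
    have : e = h - a * v * i := by rw [hev]; ring
    rw [this]
    exact H.sub_mem hh (H.mul_mem_left _ hiH)
  obtain ⟨f, hf⟩ : ∃ f, f = u + i * v := ⟨_, rfl⟩
  have hef : 1 = e + a * f := by rw [← hhk, hev, hf]; ring
  have hdf : d f = 0 := by
    have h := congrArg d hef
    rw [map_add, he, zero_add, d.map_one_eq_zero, d.map_constant_mul hda] at h
    exact (smul_eq_zero.1 h.symm).resolve_left ha0
  have hdiv : ∀ x ∈ I, ∃ s : S, e * (x : S) = i * s := by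
    intro x hx
    have : (x : S) * e ∈ Ideal.span {(i : S)} := hH ▸ Ideal.mul_mem_mul (hIJ x hx) heH
    obtain ⟨s, hs⟩ := Ideal.mem_span_singleton'.1 this
    exact ⟨s, by rw [mul_comm e, ← hs, mul_comm]⟩
  have hi0' : algebraMap S F i ≠ 0 := by
    rw [Ne, FaithfulSMul.algebraMap_eq_zero_iff]
    exact hi0
  -- Here `z = e² / i` and `w = f (1 + e)`, so `z i + w a = e² + (1 - e)(1 + e) = 1`. The square
  -- provides one factor `e` for each of `x` and `y` in `z x y`.
  refine ⟨i, hi, a, ha, algebraMap S F (e * e) / algebraMap S F i, algebraMap S F (f * (1 + e)),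
    ?_, fun x hx y hy => ⟨?_, ?_⟩⟩
  · rw [div_mul_cancel₀ _ hi0', ← map_mul, ← map_add, ← map_one (algebraMap S F)]
    congr 1
    linear_combination -(1 + e) * hef
  · obtain ⟨s, hs⟩ := hdiv x hx
    obtain ⟨t, ht⟩ := hdiv y hy
    obtain ⟨r, hr, hrs⟩ := hd.exists_mem_eq_mul_mul I ha ha0 hda hi
      (I.mul_mem_left ⟨e, mem_twistedSubring_of_eq_zero he⟩ hx)
      (I.mul_mem_left ⟨e, mem_twistedSubring_of_eq_zero he⟩ hy) (s := s) (t := t)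
      (by simpa using hs) (by simpa using ht)
    refine ⟨r, hr, ?_⟩
    rw [div_mul_eq_mul_div, div_mul_eq_mul_div, eq_div_iff hi0']
    simp only [← map_mul]
    congr 1
    rw [hrs]
    linear_combination -(e * y) * hs - i * s * ht
  · have hd2 : d (f * (1 + e)) = 0 := by
      rw [d.map_constant_mul hdf, map_add, he, d.map_one_eq_zero, add_zero, smul_zero]
    refine ⟨⟨_, mem_twistedSubring_of_eq_zero hd2⟩ * x * y,
      I.mul_mem_left _ hy, ?_⟩
    simp

end Twisted

/-! ### From dual bases to projectivity over the endomorphism ring -/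

/-- An ideal of a domain that has a dual basis, with two elements, relative to its endomorphism
ring is stable. -/
theorem IsStableIdeal.of_dual_basis {R F : Type*} [CommRing R] [IsDomain R] [Field F] [Algebra R F]
    [IsFractionRing R F] {I : Ideal R} {i a : R} (hi : i ∈ I) (ha : a ∈ I) {z w : F}
    (hzw : z * algebraMap R F i + w * algebraMap R F a = 1)
    (hz : ∀ x ∈ I, ∀ y ∈ I, ∃ r ∈ I, algebraMap R F r = z * algebraMap R F x * algebraMap R F y)
    (hw : ∀ x ∈ I, ∀ y ∈ I, ∃ r ∈ I, algebraMap R F r = w * algebraMap R F x * algebraMap R F y) :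
    IsStableIdeal I := by
  have hinj : Function.Injective (algebraMap R F) := IsFractionRing.injective R F
  have key : ∀ z : F, (∀ x ∈ I, ∀ y ∈ I, ∃ r ∈ I,
      algebraMap R F r = z * algebraMap R F x * algebraMap R F y) →
      ∃ φ : I →ₗ[Module.End R I] Module.End R I, ∀ x y : I,
        algebraMap R F (φ x y : I) = z * algebraMap R F x * algebraMap R F y := by
    intro z hz
    choose! g hg hgz using hz
    obtain ⟨p, q, hq, rfl⟩ := IsFractionRing.div_surjective (A := R) z
    have hq0 : algebraMap R F q ≠ 0 := by
      simpa using (IsFractionRing.to_map_eq_zero_iff (K := F)).not.2 (nonZeroDivisors.ne_zero hq)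
    let ψ (x : I) : Module.End R I :=
      { toFun := fun y => ⟨g x y, hg x x.2 y y.2⟩
        map_add' := fun y y' => by
          apply Subtype.ext
          apply hinj
          simp only [Submodule.coe_add, map_add]
          rw [← Submodule.coe_add, hgz x x.2 _ (y + y').2, hgz x x.2 y y.2, hgz x x.2 y' y'.2]
          simp only [Submodule.coe_add, map_add]
          ring
        map_smul' := fun c y => by
          apply Subtype.ext
          apply hinj
          simp only [RingHom.id_apply, Submodule.coe_smul, smul_eq_mul, map_mul]
          rw [← smul_eq_mul, ← Submodule.coe_smul, hgz x x.2 _ (c • y).2, hgz x x.2 y y.2]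
          simp only [Submodule.coe_smul, smul_eq_mul, map_mul]
          ring }
    have hψ : ∀ x y : I, algebraMap R F (ψ x y : I)
        = algebraMap R F p / algebraMap R F q * algebraMap R F x * algebraMap R F y :=
      fun x y => hgz x x.2 y y.2
    refine ⟨{ toFun := ψ, map_add' := fun x x' => ?_, map_smul' := fun θ x => ?_ }, hψ⟩
    · refine LinearMap.ext fun y => Subtype.ext (hinj ?_)
      simp only [LinearMap.add_apply, Submodule.coe_add, map_add, hψ]
      ring
    · refine LinearMap.ext fun y => Subtype.ext (hinj ?_)
      -- Linearity over all endomorphisms: an `R`-endomorphism commutes with multiplication by `z =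
      -- p / q`, as is seen after clearing the denominator.
      have h1 : q • ψ x y = (p * (y : R)) • x := by
        refine Subtype.ext (hinj ?_)
        simp only [Submodule.coe_smul, smul_eq_mul, map_mul, hψ]
        field_simp
      have h2 : q • θ (ψ x y) = (p * (y : R)) • θ x := by rw [← map_smul, h1, map_smul]
      have h3 := congrArg (fun v : I => algebraMap R F v) h2
      simp only [Submodule.coe_smul, smul_eq_mul, map_mul] at h3
      simp only [RingHom.id_apply, smul_eq_mul, Module.End.mul_apply, hψ, Module.End.smul_def]
      apply mul_left_cancel₀ hq0
      rw [h3]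
      field_simp
  obtain ⟨φ, hφ⟩ := key z hz
  obtain ⟨ψ, hψ⟩ := key w hw
  refine Module.Projective.of_split (φ.prod ψ)
    ((LinearMap.toSpanSingleton (Module.End R I) I ⟨i, hi⟩).coprod
      (LinearMap.toSpanSingleton (Module.End R I) I ⟨a, ha⟩)) ?_
  refine LinearMap.ext fun x => Subtype.ext (hinj ?_)
  simp only [LinearMap.comp_apply, LinearMap.prod_apply, Function.prod, LinearMap.coprod_apply,
    LinearMap.toSpanSingleton_apply, Module.End.smul_def, LinearMap.id_apply, Submodule.coe_add,
    map_add, hφ, hψ]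
  linear_combination algebraMap R F x * hzw

/-! ### Quotient field, integral closure and maximal ideals of a twisted subring -/

section FractionField

variable {S F V : Type*} [CommRing S] [IsDomain S] [Field F] [Algebra S F] [IsFractionRing S F]
  [AddCommGroup V] [Module S V] {d : Derivation ℤ S V} {L : Submodule S V}

/-- In effect `V = d(S) + L`; the factor `a` comes from dividing `v` by `a` beforehand. This
surjectivity onto `V / L` later lifts vectors of `L` to elements of the maximal ideals. -/
theorem HasDenseKernel.exists_eq_smul_add [Module F V] [IsScalarTower S F V]
    (hd : HasDenseKernel d) (hspan : Submodule.span F (Set.range d) = ⊤)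
    (hL : ∀ v : V, ∃ s : S, s ≠ 0 ∧ s • v ∈ L) {a : S} (ha : a ≠ 0) (v : V) :
    ∃ s : S, ∃ l ∈ L, v = a • (d s + l) := by
  have main : ∀ v : V, ∃ s : S, ∃ l ∈ L, v = d s + l := by
    intro v
    have hv : v ∈ Submodule.span F (Set.range d) := hspan ▸ Submodule.mem_top
    induction hv using Submodule.closure_induction with
    | zero => exact ⟨0, 0, L.zero_mem, by simp⟩
    | add x y _ _ hx hy =>
      obtain ⟨s, l, hl, rfl⟩ := hx
      obtain ⟨t, m, hm, rfl⟩ := hy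
      exact ⟨s + t, l + m, L.add_mem hl hm, by rw [map_add]; abel⟩
    | smul_mem f x hx =>
      obtain ⟨s, rfl⟩ := hx
      obtain ⟨g, h, hh, rfl⟩ := IsFractionRing.div_surjective (A := S) f
      have hh0 := nonZeroDivisors.ne_zero hh
      obtain ⟨u, hu, hdu⟩ := hd.exists_constant_mul hh0
      -- With the constant denominator `q = h u`, write `s = e + q t`, so `(g / h) • d s = (g u) • d
      -- t`. Replacing `g u` by a constant `c` modulo `q b` gives `d (c t)` plus an element of `L`,
      -- since `b q • d t ∈ L`.
      obtain ⟨b, hb, hdb, hbs⟩ := hd.exists_constant_smul_mem hL (d s)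
      obtain ⟨c, w, hc, hw⟩ := hd (h * u * b) (mul_ne_zero hu hb) (g * u)
      obtain ⟨e, t, he, rfl⟩ := hd (h * u) hu s
      rw [map_add, he, zero_add, d.map_constant_mul hdu] at hbs ⊢
      refine ⟨c * t, w • b • (h * u) • d t, L.smul_mem _ hbs, ?_⟩
      rw [d.map_constant_mul hc]
      have hne : algebraMap S F (h * u) ≠ 0 := by
        simpa using (IsFractionRing.to_map_eq_zero_iff (K := F)).not.2 hu
      have : algebraMap S F g / algebraMap S F h =
          algebraMap S F (g * u) / algebraMap S F (h * u) := by
        have h1 : algebraMap S F h ≠ 0 := (IsFractionRing.to_map_eq_zero_iff (K := F)).not.2 hh0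
        rw [div_eq_div_iff h1 hne, ← map_mul, ← map_mul]
        congr 1
        ring
      rw [this, ← algebraMap_smul F (h * u) (d t), smul_smul, div_mul_cancel₀ _ hne,
        algebraMap_smul, algebraMap_smul, hw]
      module
  have ha' : algebraMap S F a ≠ 0 := (IsFractionRing.to_map_eq_zero_iff (K := F)).not.2 ha
  obtain ⟨s, l, hl, h⟩ := main ((algebraMap S F a)⁻¹ • v)
  refine ⟨s, l, hl, ?_⟩
  rw [← h, ← algebraMap_smul F, smul_inv_smul₀ ha']

theorem HasDenseKernel.isFractionRing (hd : HasDenseKernel d)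
    (hL : ∀ v : V, ∃ s : S, s ≠ 0 ∧ s • v ∈ L) : IsFractionRing (twistedSubring d L) F := by
  have : FaithfulSMul (twistedSubring d L) F := by
    rw [faithfulSMul_iff_algebraMap_injective]
    exact (IsFractionRing.injective S F).comp Subtype.val_injective
  refine IsFractionRing.of_field _ F fun z => ?_
  obtain ⟨p, q, hq, rfl⟩ := IsFractionRing.div_surjective (A := S) z
  obtain ⟨a, ha, hda, hap⟩ := hd.exists_constant_smul_mem hL (d p)
  obtain ⟨b, hb, hdb, hbq⟩ := hd.exists_constant_smul_mem hL (d q)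
  refine ⟨⟨b * (a * p), ?_⟩, ⟨a * (b * q), ?_⟩, ?_⟩
  · rw [mem_twistedSubring, d.map_constant_mul hdb, d.map_constant_mul hda]
    exact L.smul_mem _ hap
  · rw [mem_twistedSubring, d.map_constant_mul hda, d.map_constant_mul hdb]
    exact L.smul_mem _ hbq
  · change algebraMap S F p / algebraMap S F q =
      algebraMap S F (b * (a * p)) / algebraMap S F (a * (b * q))
    have hne : ∀ x : S, x ≠ 0 → algebraMap S F x ≠ 0 := fun x hx =>
      (IsFractionRing.to_map_eq_zero_iff (K := F)).not.2 hx
    have h1 := hne q (nonZeroDivisors.ne_zero hq)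
    have h2 := hne a ha
    have h3 := hne b hb
    simp only [map_mul]
    field_simp

theorem HasDenseKernel.isIntegral (hd : HasDenseKernel d)
    (hL : ∀ v : V, ∃ s : S, s ≠ 0 ∧ s • v ∈ L) : Algebra.IsIntegral (twistedSubring d L) S := by
  refine ⟨fun s => ?_⟩
  obtain ⟨a, ha, hda, has⟩ := hd.exists_constant_smul_mem hL (d s)
  obtain ⟨c, w, hc, rfl⟩ := hd a ha s
  have h1 : IsIntegral (twistedSubring d L) c :=
    isIntegral_algebraMap (x := (⟨c, mem_twistedSubring_of_eq_zero hc⟩ : twistedSubring d L))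
  -- Thus `s` is a constant plus a square root of an element of the subring: `d ((a w)²) = 2 w a² •
  -- d w`, and `a² • d w = a • d s` is in `L`.
  have h2 : (a * w) ^ 2 ∈ twistedSubring d L := by
    rw [map_add, hc, zero_add, d.map_constant_mul hda] at has
    rw [mem_twistedSubring, sq, d.leibniz, d.map_constant_mul hda]
    have := L.smul_mem (2 * w) has
    convert this using 1
    module
  exact h1.add (.of_pow two_pos
    (isIntegral_algebraMap (x := (⟨_, h2⟩ : twistedSubring d L))))

theorem HasDenseKernel.isIntegralClosure [IsIntegrallyClosed S] (hd : HasDenseKernel d)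
    (hL : ∀ v : V, ∃ s : S, s ≠ 0 ∧ s • v ∈ L) : IsIntegralClosure S (twistedSubring d L) F := by
  have := hd.isIntegral hL
  refine ⟨IsFractionRing.injective S F, fun {x} => ⟨fun hx => ?_, ?_⟩⟩
  · exact IsIntegrallyClosed.isIntegral_iff.1 (hx.tower_top (A := S))
  · rintro ⟨y, rfl⟩
    exact (Algebra.IsIntegral.isIntegral (R := twistedSubring d L) y).algebraMap

/-- Constants already separate maximal ideals: an element of `N` outside `P` can be moved to a
constant modulo a nonzero element of `N ∩ P`. -/
theorem comap_twistedSubring_injective (hd : HasDenseKernel d) (hS : ¬ IsField S)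
    {N P : Ideal S} (hN : N.IsMaximal) (hP : P.IsMaximal)
    (h : N.comap (twistedSubring d L).subtype = P.comap (twistedSubring d L).subtype) : N = P := by
  by_contra hne
  obtain ⟨s, hsN, hsP⟩ : ∃ s ∈ N, s ∉ P := by
    by_contra! hle
    exact hne (hN.eq_of_le hP.ne_top hle)
  obtain ⟨n, hn, hn0⟩ := Submodule.exists_mem_ne_zero_of_ne_bot
    (Ring.ne_bot_of_isMaximal_of_not_isField hN hS)
  obtain ⟨p, hp, hp0⟩ := Submodule.exists_mem_ne_zero_of_ne_bot
    (Ring.ne_bot_of_isMaximal_of_not_isField hP hS)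
  obtain ⟨c, u, hc, rfl⟩ := hd (n * p) (mul_ne_zero hn0 hp0) s
  have hnN : n * p * u ∈ N := N.mul_mem_right _ (N.mul_mem_right _ hn)
  have hpP : n * p * u ∈ P := P.mul_mem_right _ (P.mul_mem_left _ hp)
  have h1 : c ∈ N := (N.add_mem_iff_left hnN).1 hsN
  have h2 : (⟨c, mem_twistedSubring_of_eq_zero hc⟩ : twistedSubring d L) ∈
      N.comap (twistedSubring d L).subtype := h1
  rw [h] at h2
  exact hsP (P.add_mem h2 hpP)

/-- Contraction is a bijection from the maximal ideals of `S` to those of a twisted subring. -/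
noncomputable def HasDenseKernel.maximalSpectrumEquiv (hd : HasDenseKernel d) (hS : ¬ IsField S)
    (hL : ∀ v : V, ∃ s : S, s ≠ 0 ∧ s • v ∈ L) :
    MaximalSpectrum S ≃ MaximalSpectrum (twistedSubring d L) :=
  have := hd.isIntegral hL
  Equiv.ofBijective
    (fun N => ⟨N.asIdeal.comap (twistedSubring d L).subtype,
      have := N.isMaximal
      Ideal.isMaximal_comap_of_isIntegral_of_isMaximal (R := twistedSubring d L) N.asIdeal⟩) <| by
    refine ⟨fun N P h => MaximalSpectrum.ext ?_, fun M => ?_⟩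
    · exact comap_twistedSubring_injective hd hS N.isMaximal P.isMaximal
        (congrArg MaximalSpectrum.asIdeal h)
    · have := M.isMaximal
      obtain ⟨Q, hQ, h⟩ := Ideal.exists_ideal_over_maximal_of_isIntegral (S := S) M.asIdeal (by
        rw [(RingHom.injective_iff_ker_eq_bot _).1
          (Subtype.val_injective : Function.Injective (algebraMap (twistedSubring d L) S))]
        exact bot_le)
      exact ⟨⟨Q, hQ⟩, MaximalSpectrum.ext h⟩

end FractionField

/-- A twisted subring of a Dedekind domain is a stable domain. -/
theorem HasDenseKernel.isStableDomain {S V : Type*} (F : Type*) [CommRing S] [IsDedekindDomain S]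
    [Field F] [Algebra S F] [IsFractionRing S F]
    [AddCommGroup V] [Module S V] [Module.IsTorsionFree S V] {d : Derivation ℤ S V}
    {L : Submodule S V} (hd : HasDenseKernel d) (hL : ∀ v : V, ∃ s : S, s ≠ 0 ∧ s • v ∈ L) :
    IsStableDomain (twistedSubring d L) := by
  refine ⟨inferInstance, fun I => ?_⟩
  by_cases hI : I = ⊥
  · subst hI
    exact Module.Projective.of_free
  have := hd.isFractionRing (F := F) hL
  obtain ⟨i, hi, a, ha, z, w, hzw, h⟩ := hd.exists_dual_basis (F := F) hI
  exact IsStableIdeal.of_dual_basis (F := F) hi ha hzw (fun x hx y hy => (h x hx y hy).1)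
    fun x hx y hy => (h x hx y hy).2

/-! ### Counting generators of the maximal ideals -/

/-- A constant local parameter `a` at a maximal ideal `N` of a Dedekind domain, with a constant
`t` that is a unit at `N` and divisible by `a` away from `N`. -/
theorem HasDenseKernel.exists_uniformizer {S V : Type*} [CommRing S] [IsDedekindDomain S]
    [AddCommGroup V] [Module S V] {d : Derivation ℤ S V} (hd : HasDenseKernel d) {N : Ideal S}
    (hN : N.IsMaximal) (hN0 : N ≠ ⊥) :
    ∃ a t : S, d a = 0 ∧ d t = 0 ∧ a ≠ 0 ∧ a ∈ N ∧ a ∉ N ^ 2 ∧ 1 - t ∈ N ∧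
      ∀ n ∈ N, ∃ g, t * n = a * g := by
  have hlt : N ^ 2 < N := by
    simpa using Ideal.pow_right_strictAnti N hN0 hN.ne_top one_lt_two
  obtain ⟨s, hsN, hs⟩ := SetLike.exists_of_lt hlt
  obtain ⟨n, hn, hn0⟩ := Submodule.exists_mem_ne_zero_of_ne_bot (pow_ne_zero 2 hN0)
  obtain ⟨a, u, ha, rfl⟩ := hd n hn0 s
  have haN2 : a ∉ N ^ 2 := fun h => hs (Ideal.add_mem _ h (Ideal.mul_mem_right _ _ hn))
  have haN : a ∈ N := (N.add_mem_iff_left (N.mul_mem_right _ (hlt.le hn))).1 hsN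
  have ha0 : a ≠ 0 := fun h => haN2 (h ▸ Ideal.zero_mem _)
  -- `H` is the part of `(a)` away from `N`; any constant `t ∈ H` congruent to `1` modulo `N`
  -- satisfies `t N ⊆ N H = (a)`.
  obtain ⟨H, hH⟩ : N ∣ Ideal.span {a} :=
    Ideal.dvd_iff_le.2 ((Ideal.span_singleton_le_iff_mem _).2 haN)
  have haNH : a ∈ N * H := hH ▸ Ideal.mem_span_singleton_self a
  have hHN : ¬ H ≤ N := fun h => haN2 (by rw [sq]; exact Ideal.mul_mono_right h haNH)
  obtain ⟨x, hx, y, hy, hxy⟩ := Submodule.mem_sup.1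
    ((Ideal.eq_top_iff_one _).1 (hN.1.2 _ (left_lt_sup.2 hHN)))
  obtain ⟨t, w, ht, rfl⟩ := hd a ha0 y
  have haH : a ∈ H := Ideal.mul_le_right haNH
  have htH : t ∈ H := (H.add_mem_iff_left (H.mul_mem_right _ haH)).1 hy
  refine ⟨a, t, ha, ht, ha0, haN, haN2, ?_, fun n hn => ?_⟩
  · have : 1 - t = x + a * w := by rw [← hxy]; ring
    rw [this]
    exact N.add_mem hx (N.mul_mem_right _ haN)
  · have : n * t ∈ Ideal.span {a} := hH ▸ Ideal.mul_mem_mul hn htH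
    obtain ⟨g, hg⟩ := Ideal.mem_span_singleton'.1 this
    exact ⟨g, by rw [mul_comm t, ← hg, mul_comm]⟩

theorem fg_of_minGenerators_ne_top {R : Type*} [CommRing R] {I : Ideal R}
    (h : minGenerators I ≠ ⊤) : I.FG := by
  by_contra hI
  refine h (iInf₂_eq_top.2 fun s hs => Set.encard_eq_top fun hfin => hI ?_)
  exact ⟨hfin.toFinset, by simpa using hs⟩

/-- A linearly independent family modulo `M ^ 2` bounds the number of generators of `M`. -/
theorem le_minGenerators_of_forall_sum_mem {R : Type*} [CommRing R] {M : Ideal R} (hM : M.IsMaximal)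
    {ι : Type*} [Fintype ι] (y : ι → R) (hy : ∀ j, y j ∈ M)
    (h : ∀ c : ι → R, ∑ j, c j * y j ∈ M ^ 2 → ∀ j, c j ∈ M) :
    (Fintype.card ι : ℕ∞) ≤ minGenerators M := by
  classical
  let := Ideal.Quotient.field M
  refine le_iInf₂ fun s hs => ?_
  rcases s.finite_or_infinite with hfin | hinf
  swap
  · simp [hinf.encard_eq]
  have := hfin.fintype
  have hsM : ∀ x ∈ s, x ∈ M := fun x hx => hs ▸ Ideal.subset_span hx
  let w : s → M.Cotangent := fun x => M.toCotangent ⟨x, hsM x x.2⟩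
  have hw : Submodule.span (R ⧸ M) (Set.range w) = ⊤ := by
    rw [eq_top_iff]
    rintro z -
    obtain ⟨⟨x, hx⟩, rfl⟩ := M.toCotangent_surjective z
    have hxs : x ∈ Submodule.span R s := by
      rw [← hs] at hx
      exact hx
    induction hxs using Submodule.span_induction with
    | mem x h => exact Submodule.subset_span ⟨⟨x, h⟩, rfl⟩
    | zero =>
      have : (⟨0, hx⟩ : M) = 0 := rfl
      rw [this, map_zero]
      exact Submodule.zero_mem _
    | add a b ha hb iha ihb =>
      have ha : a ∈ M := hs ▸ ha
      have hb : b ∈ M := hs ▸ hb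
      have : (⟨a + b, hx⟩ : M) = ⟨a, ha⟩ + ⟨b, hb⟩ := rfl
      rw [this, map_add]
      exact Submodule.add_mem _ (iha ha) (ihb hb)
    | smul r a ha iha =>
      have ha : a ∈ M := hs ▸ ha
      have : (⟨r • a, hx⟩ : M) = r • ⟨a, ha⟩ := rfl
      rw [this, map_smul]
      exact Submodule.smul_mem _ (Ideal.Quotient.mk M r) (iha ha)
  have hli : LinearIndependent (R ⧸ M) fun j => M.toCotangent ⟨y j, hy j⟩ := by
    rw [Fintype.linearIndependent_iff]
    intro g hg j
    choose c hc using fun j => Ideal.Quotient.mk_surjective (g j)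
    rw [← hc j, Ideal.Quotient.eq_zero_iff_mem]
    refine h c ?_ j
    have h1 : M.toCotangent (∑ j, c j • (⟨y j, hy j⟩ : M)) = 0 := by
      rw [map_sum, ← hg]
      refine Finset.sum_congr rfl fun j _ => ?_
      rw [map_smul, ← hc j]
      rfl
    rw [Ideal.toCotangent_eq_zero] at h1
    simpa using h1
  have hcard := linearIndependent_le_span _ hli (Set.range w) hw
  have h2 : Fintype.card ι ≤ Fintype.card s := by
    rw [Cardinal.mk_fintype, Nat.cast_le] at hcard
    exact hcard.trans (Fintype.card_range_le w)
  rw [Set.encard_eq_coe_toFinset_card, Set.toFinset_card]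
  exact_mod_cast h2

section Generators

variable {S F V : Type*} [CommRing S] [IsDedekindDomain S] [Field F] [Algebra S F]
  [IsFractionRing S F] [AddCommGroup V] [Module S V] [Module F V] [IsScalarTower S F V]
  {d : Derivation ℤ S V} {L : Submodule S V}

/-- The generators are `a` and lifts `a s_j` with `d (a s_j) ≡ k_j` modulo `a L`, adjusted by `t`.
For `x ∈ M`, subtracting multiples of the lifts from `t x` leaves `a` times an element of the
subring. -/
theorem HasDenseKernel.minGenerators_comap_le [Module.IsTorsionFree S V] (hd : HasDenseKernel d)
    (hspan : Submodule.span F (Set.range d) = ⊤) (hL : ∀ v : V, ∃ s : S, s ≠ 0 ∧ s • v ∈ L)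
    {N : Ideal S} (hN : N.IsMaximal) (hN0 : N ≠ ⊥) {m : ℕ} (k : Fin (m + 1) → V)
    (hk : ∀ j, k j ∈ L)
    (hkL : ∀ v ∈ L, ∃ c : Fin (m + 1) → S, v - ∑ j, c j • k j ∈ N • L) :
    minGenerators (N.comap (twistedSubring d L).subtype) ≤ (m + 1 : ℕ) + 1 := by
  obtain ⟨a, t, hda, hdt, ha0, haN, -, htN, hta⟩ := hd.exists_uniformizer hN hN0
  choose s l hl hs using fun j => hd.exists_eq_smul_add hspan hL ha0 (k j)
  have htL : ∀ n ∈ N • L, ∃ l ∈ L, t • n = a • l := by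
    intro n hn
    induction hn using Submodule.smul_induction_on' with
    | smul r hr n hn =>
      obtain ⟨g, hg⟩ := hta r hr
      exact ⟨g • n, L.smul_mem _ hn, by rw [smul_smul, smul_smul, hg]⟩
    | add x _ y _ hx hy =>
      obtain ⟨l, hl, h⟩ := hx
      obtain ⟨l', hl', h'⟩ := hy
      exact ⟨l + l', L.add_mem hl hl', by rw [smul_add, smul_add, h, h']⟩
  have hm : ∀ j, a * s j ∈ twistedSubring d L := fun j => by
    have : a • d (s j) = k j - a • l j := by rw [hs j]; module
    rw [mem_twistedSubring, d.map_constant_mul hda, this]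
    exact L.sub_mem (hk j) (L.smul_mem _ (hl j))
  obtain ⟨f, hf⟩ := hta _ htN
  have hdf : d f = 0 := by
    have h := congrArg d hf
    rw [d.map_constant_mul hdt, d.map_constant_mul hda, map_sub, hdt, d.map_one_eq_zero, sub_zero,
      smul_zero] at h
    exact (smul_eq_zero.1 h.symm).resolve_left ha0
  let a' : twistedSubring d L := ⟨a, mem_twistedSubring_of_eq_zero hda⟩
  let t' : twistedSubring d L := ⟨t, mem_twistedSubring_of_eq_zero hdt⟩
  let f' : twistedSubring d L := ⟨f, mem_twistedSubring_of_eq_zero hdf⟩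
  let m' : Fin (m + 1) → twistedSubring d L := fun j => ⟨_, hm j⟩
  have hf' : t' * (1 - t') = a' * f' := Subtype.ext hf
  -- The element `1 - t` is also needed; adding it to the generator of index `0` avoids an extra
  -- one. It is recovered because `t (1 - t)` is a multiple of `a`. This is why at least one `k_j`
  -- is required.
  let y : Fin (m + 1) → twistedSubring d L := fun j => t' * m' j + if j = 0 then 1 - t' else 0
  have ha'N : a' ∈ N.comap (twistedSubring d L).subtype := haN
  have hm'N : ∀ j, m' j ∈ N.comap (twistedSubring d L).subtype := fun j => N.mul_mem_right _ haN
  have ht'N : 1 - t' ∈ N.comap (twistedSubring d L).subtype := htN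
  set Q := Ideal.span (insert a' (Set.range y)) with hQ
  have haQ : a' ∈ Q := Ideal.subset_span (Set.mem_insert _ _)
  have hyQ : ∀ j, y j ∈ Q := fun j => Ideal.subset_span (Set.mem_insert_of_mem _ ⟨j, rfl⟩)
  have htQ : 1 - t' ∈ Q := by
    have h1 : 1 - t' = (1 - t') * y 0 + (f' - f' * m' 0) * a' := by
      simp only [y, if_true]
      linear_combination (1 - m' 0) * hf'
    rw [h1]
    exact Q.add_mem (Q.mul_mem_left _ (hyQ 0)) (Q.mul_mem_left _ haQ)
  have htmQ : ∀ j, t' * m' j ∈ Q := by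
    intro j
    have h1 : t' * m' j = y j - if j = 0 then 1 - t' else 0 := by simp [y]
    rw [h1]
    refine Q.sub_mem (hyQ j) ?_
    split_ifs
    · exact htQ
    · exact Q.zero_mem
  have hle : N.comap (twistedSubring d L).subtype ≤ Q := by
    intro x hx
    obtain ⟨g, hg⟩ := hta x hx
    obtain ⟨c, hc⟩ := hkL (d x) x.2
    obtain ⟨n, hn, htn⟩ := htL _ hc
    choose c' u hc' hcu using fun j => hd a ha0 (c j)
    -- Since `a • d g = t • d x`, the constants `c' j` cancel the part of `d g` that might lie
    -- outside `L`; torsion-freeness allows the check after multiplying by `a`.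
    have hg' : g - ∑ j, c' j * (t * s j) ∈ twistedSubring d L := by
      have h1 : d g - ∑ j, c' j • t • d (s j)
          = n + ∑ j, (u j • t • k j + c' j • t • l j) := by
        have h2 : a • d g = t • d x := by
          rw [← d.map_constant_mul hda, ← d.map_constant_mul hdt, hg]
        have h3 : t • d x = a • n + ∑ j, t • c j • k j := by
          rw [← htn, smul_sub, Finset.smul_sum]
          abel
        apply smul_right_injective V ha0
        simp only
        rw [smul_sub, h2, h3, smul_add, Finset.smul_sum, Finset.smul_sum, add_sub_assoc,
          ← Finset.sum_sub_distrib]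
        congr 1
        refine Finset.sum_congr rfl fun j _ => ?_
        rw [hcu j]
        have h4 : a • d (s j) = k j - a • l j := by rw [hs j]; module
        have h5 : a • c' j • t • d (s j) = (c' j * t) • a • d (s j) := by module
        rw [h5, h4]
        module
      rw [mem_twistedSubring, map_sub, map_sum]
      simp only [d.map_constant_mul (hc' _), d.map_constant_mul hdt]
      rw [h1]
      exact L.add_mem hn (L.sum_mem fun j _ => L.add_mem (L.smul_mem _ (L.smul_mem _ (hk j)))
        (L.smul_mem _ (L.smul_mem _ (hl j))))
    have h6 : x = (1 - t') * x + (a' * ⟨_, hg'⟩ +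
        ∑ j, (⟨c' j, mem_twistedSubring_of_eq_zero (hc' j)⟩ : twistedSubring d L) * (t' * m' j)) := by
      apply Subtype.ext
      simp only [Subring.coe_add, Subring.coe_mul, AddSubgroupClass.coe_sub, Subring.coe_one,
        AddSubmonoidClass.coe_finsetSum, a', t', m']
      have h7 : ∀ j, c' j * (t * (a * s j)) = a * (c' j * (t * s j)) := fun j => by ring
      simp only [h7, ← Finset.mul_sum]
      linear_combination hg
    rw [h6]
    exact Q.add_mem (Q.mul_mem_right _ htQ) (Q.add_mem (Q.mul_mem_right _ haQ)
      (Q.sum_mem fun j _ => Q.mul_mem_left _ (htmQ j)))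
  have hge : Q ≤ N.comap (twistedSubring d L).subtype := by
    rw [hQ, Ideal.span_le, Set.insert_subset_iff]
    refine ⟨ha'N, ?_⟩
    rintro _ ⟨j, rfl⟩
    refine Ideal.add_mem _ (Ideal.mul_mem_left _ _ (hm'N j)) ?_
    split_ifs
    · exact ht'N
    · exact Ideal.zero_mem _
  calc minGenerators (N.comap (twistedSubring d L).subtype)
      ≤ (insert a' (Set.range y)).encard := 
        iInf₂_le (f := fun s (_ : Ideal.span s = _) => s.encard) _ (le_antisymm hge hle)
    _ ≤ (Set.range y).encard + 1 := Set.encard_insert_le _ _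
    _ ≤ (m + 1 : ℕ) + 1 := by
      gcongr
      rw [← Set.image_univ]
      refine (Set.encard_image_le _ _).trans ?_
      simp

/-- The elements `a` and `a² s_j`, with `d (a² s_j) ≡ k_j` modulo `a² L`, are independent modulo `M
^ 2`. The factor `a²` places the lifts in `N ^ 2`, so reduction modulo `N ^ 2` isolates the
coefficient of `a`, and applying `d` modulo `N L` detects the others. -/
theorem HasDenseKernel.le_minGenerators_comap (hd : HasDenseKernel d)
    (hspan : Submodule.span F (Set.range d) = ⊤) (hL : ∀ v : V, ∃ s : S, s ≠ 0 ∧ s • v ∈ L)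
    {N : Ideal S} (hN : N.IsMaximal) (hN0 : N ≠ ⊥) {m : ℕ} (k : Fin m → V) (hk : ∀ j, k j ∈ L)
    (hind : ∀ c : Fin m → S, ∑ j, c j • k j ∈ N • L → ∀ j, c j ∈ N) :
    (m : ℕ∞) + 1 ≤ minGenerators (N.comap (twistedSubring d L).subtype) := by
  obtain ⟨a, -, hda, -, ha0, haN, haN2, -, -⟩ := hd.exists_uniformizer hN hN0
  have haa : d (a * a) = 0 := by rw [d.map_constant_mul hda, hda, smul_zero]
  choose s l hl hs using fun j => hd.exists_eq_smul_add hspan hL (mul_ne_zero ha0 ha0) (k j)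
  have hm : ∀ j, d (a * a * s j) = k j - (a * a) • l j := fun j => by
    rw [d.map_constant_mul haa, hs j]
    module
  have := hd.isIntegral hL
  have hM : (N.comap (twistedSubring d L).subtype).IsMaximal :=
    Ideal.isMaximal_comap_of_isIntegral_of_isMaximal (R := twistedSubring d L) N
  have hsq : ∀ x ∈ N.comap (twistedSubring d L).subtype ^ 2, (x : S) ∈ N ^ 2 ∧ d x ∈ N • L := by
    intro x hx
    rw [sq] at hx
    induction hx using Submodule.mul_induction_on' with
    | mem_mul_mem x hx y hy =>
      refine ⟨?_, ?_⟩
      · rw [sq]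
        exact Ideal.mul_mem_mul hx hy
      · rw [Subring.coe_mul, d.leibniz]
        exact Submodule.add_mem _ (Submodule.smul_mem_smul hx y.2)
          (Submodule.smul_mem_smul hy x.2)
    | add x _ y _ hx hy =>
      refine ⟨Ideal.add_mem _ hx.1 hy.1, ?_⟩
      rw [Subring.coe_add, map_add]
      exact Submodule.add_mem _ hx.2 hy.2
  let y : Option (Fin m) → twistedSubring d L := fun j => j.elim
    ⟨a, mem_twistedSubring_of_eq_zero hda⟩ fun j => ⟨a * a * s j, by
      rw [mem_twistedSubring, hm]
      exact L.sub_mem (hk j) (L.smul_mem _ (hl j))⟩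
  have hy : ∀ j, y j ∈ N.comap (twistedSubring d L).subtype := by
    rintro (_ | j)
    · exact haN
    · exact N.mul_mem_right _ (N.mul_mem_right _ haN)
  have h := le_minGenerators_of_forall_sum_mem hM y hy fun c hc => by
    rw [Fintype.sum_option] at hc
    obtain ⟨h1, h2⟩ := hsq _ hc
    simp only [Subring.coe_add, Subring.coe_mul, AddSubmonoidClass.coe_finsetSum, y,
      Option.elim] at h1 h2
    have hc0 : (c none : S) ∈ N := by
      have h3 : ∑ j, (c (some j) : S) * (a * a * s j) ∈ N ^ 2 := Ideal.sum_mem _ fun j _ =>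
        Ideal.mul_mem_left _ _ (Ideal.mul_mem_right _ _ (by
          rw [sq]
          exact Ideal.mul_mem_mul haN haN))
      exact (Ideal.IsPrime.mul_mem_pow N ((Ideal.add_mem_iff_left _ h3).1 h1)).resolve_right haN2
    rintro (_ | j)
    · exact hc0
    · refine hind (fun j => c (some j)) ?_ j
      rw [map_add, map_sum, d.map_mul_constant hda] at h2
      have h4 : ∑ j, (c (some j) : S) • k j = a • d (c none) +
          ∑ j, d ((c (some j) : S) * (a * a * s j)) - a • d (c none)
          + ∑ j, a • ((c (some j) : S) * a) • l j - ∑ j, a • (a * s j) • d (c (some j)) := by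
        rw [add_sub_cancel_left, ← Finset.sum_add_distrib, ← Finset.sum_sub_distrib]
        refine Finset.sum_congr rfl fun j _ => ?_
        rw [d.leibniz, hm]
        module
      rw [h4]
      exact Submodule.sub_mem _ (Submodule.add_mem _ (Submodule.sub_mem _ h2
        (Submodule.smul_mem_smul haN (c none).2))
        (Submodule.sum_mem _ fun j _ => Submodule.smul_mem_smul haN (L.smul_mem _ (hl j))))
        (Submodule.sum_mem _ fun j _ => Submodule.smul_mem_smul haN (L.smul_mem _ (c (some j)).2))
  simpa using h

/-- A twisted subring whose maximal ideals are finitely generated is Noetherian. -/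
theorem HasDenseKernel.isNoetherianRing (hd : HasDenseKernel d)
    (hL : ∀ v : V, ∃ s : S, s ≠ 0 ∧ s • v ∈ L)
    (h : ∀ M : MaximalSpectrum (twistedSubring d L), M.asIdeal.FG) :
    IsNoetherianRing (twistedSubring d L) := by
  have := hd.isIntegral hL
  refine IsNoetherianRing.of_prime fun P hP => ?_
  by_cases hP0 : P = ⊥
  · rw [hP0]
    exact Submodule.fg_bot
  obtain ⟨Q, -, hQ, hQP⟩ := Ideal.exists_ideal_over_prime_of_isIntegral P (⊥ : Ideal S) (by
    rw [← RingHom.ker_eq_comap_bot, (RingHom.injective_iff_ker_eq_bot _).1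
      (Subtype.val_injective : Function.Injective (algebraMap (twistedSubring d L) S))]
    exact bot_le)
  have hQ0 : Q ≠ ⊥ := by
    rintro rfl
    apply hP0
    rw [← hQP, ← RingHom.ker_eq_comap_bot, (RingHom.injective_iff_ker_eq_bot _).1
      (Subtype.val_injective : Function.Injective (algebraMap (twistedSubring d L) S))]
  have := hQ.isMaximal hQ0
  exact h ⟨P, hQP ▸ Ideal.isMaximal_comap_of_isIntegral_of_isMaximal Q⟩

end Generators

/-! ### Lattices with prescribed dimension at each maximal ideal -/

section Lattice

variable {S F V B : Type*} [CommRing S] [Field F] [Algebra S F] [AddCommGroup V] [Module S V]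
  [Module F V] [IsScalarTower S F V]

/-- The localization of `S` at a prime ideal, as a submodule of the quotient field. -/
def localSubmodule (F : Type*) [Field F] [Algebra S F] (N : Ideal S) [hN : N.IsPrime] :
    Submodule S F where
  carrier := {f | ∃ s ∉ N, ∃ u : S, s • f = algebraMap S F u}
  add_mem' := by
    rintro f g ⟨s, hs, u, hu⟩ ⟨t, ht, v, hv⟩
    refine ⟨s * t, fun h => (hN.mem_or_mem h).elim hs ht, t * u + s * v, ?_⟩
    rw [map_add, map_mul, map_mul, ← hu, ← hv]
    simp only [Algebra.smul_def, map_mul]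
    ring
  zero_mem' := ⟨1, hN.one_notMem, 0, by simp⟩
  smul_mem' := by
    rintro c f ⟨s, hs, u, hu⟩
    exact ⟨s, hs, c * u, by rw [smul_comm, hu, map_mul, Algebra.smul_def]⟩

theorem mem_localSubmodule {N : Ideal S} [N.IsPrime] {f : F} :
    f ∈ localSubmodule F N ↔ ∃ s ∉ N, ∃ u : S, s • f = algebraMap S F u := Iff.rfl

theorem algebraMap_mem_localSubmodule (N : Ideal S) [hN : N.IsPrime] (u : S) :
    algebraMap S F u ∈ localSubmodule F N :=
  ⟨1, hN.one_notMem, u, one_smul _ _⟩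

theorem mem_localSubmodule_of_smul_mem {N : Ideal S} [hN : N.IsPrime] {s : S} (hs : s ∉ N) {f : F}
    (h : s • f ∈ localSubmodule F N) : f ∈ localSubmodule F N := by
  obtain ⟨t, ht, u, hu⟩ := h
  exact ⟨t * s, fun h => (hN.mem_or_mem h).elim ht hs, u, by rw [mul_smul, hu]⟩

theorem mem_of_algebraMap_mem_smul_localSubmodule [FaithfulSMul S F] {N : Ideal S}
    [hN : N.IsPrime] {c : S} (hc : algebraMap S F c ∈ N • localSubmodule F N) : c ∈ N := by
  have key : ∀ f ∈ N • localSubmodule F N, ∃ s ∉ N, ∃ u ∈ N, s • f = algebraMap S F u := by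
    intro f hf
    induction hf using Submodule.smul_induction_on' with
    | smul r hr n hn =>
      obtain ⟨s, hs, u, hu⟩ := hn
      exact ⟨s, hs, r * u, N.mul_mem_right _ hr,
        by rw [smul_comm, hu, map_mul, Algebra.smul_def]⟩
    | add x _ y _ hx hy =>
      obtain ⟨s, hs, u, hu, hsu⟩ := hx
      obtain ⟨t, ht, v, hv, htv⟩ := hy
      refine ⟨s * t, fun h => (hN.mem_or_mem h).elim hs ht, t * u + s * v,
        N.add_mem (N.mul_mem_left _ hu) (N.mul_mem_left _ hv), ?_⟩
      rw [map_add, map_mul, map_mul, ← hsu, ← htv]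
      simp only [Algebra.smul_def, map_mul]
      ring
  obtain ⟨s, hs, u, hu, h⟩ := key _ hc
  rw [Algebra.smul_def, ← map_mul] at h
  have := FaithfulSMul.algebraMap_injective S F h
  exact (hN.mem_or_mem (this ▸ hu)).resolve_left hs

/-- The submodule of those vectors whose first `r N` coordinates along `g` are integral at `N`, for
each maximal ideal `N`. -/
noncomputable def coordinateLattice (b : Module.Basis B F V) (g : ℕ → B) (r : MaximalSpectrum S → ℕ∞) :
    Submodule S V :=
  ⨅ (N : MaximalSpectrum S) (i : ℕ) (_ : (i : ℕ∞) < r N),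
    (localSubmodule F N.asIdeal).comap ((b.coord (g i)).restrictScalars S)

variable {b : Module.Basis B F V} {g : ℕ → B} {r : MaximalSpectrum S → ℕ∞}

theorem mem_coordinateLattice {v : V} : v ∈ coordinateLattice b g r ↔
    ∀ (N : MaximalSpectrum S) (i : ℕ), (i : ℕ∞) < r N →
      b.repr v (g i) ∈ localSubmodule F N.asIdeal := by
  simp [coordinateLattice, Submodule.mem_iInf]

theorem basis_mem_coordinateLattice (i : ℕ) : b (g i) ∈ coordinateLattice b g r := by
  classical
  rw [mem_coordinateLattice]
  intro N j _
  rw [b.repr_self, Finsupp.single_apply]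
  split_ifs
  · rw [← map_one (algebraMap S F)]
    exact algebraMap_mem_localSubmodule _ _
  · exact Submodule.zero_mem _

theorem exists_smul_mem_coordinateLattice [IsDomain S] [IsFractionRing S F] (v : V) :
    ∃ s : S, s ≠ 0 ∧ s • v ∈ coordinateLattice b g r := by
  classical
  obtain ⟨s, hs⟩ := IsLocalization.exist_integer_multiples_of_finset (nonZeroDivisors S)
    ((b.repr v).support.image (b.repr v))
  refine ⟨s, nonZeroDivisors.ne_zero s.2, mem_coordinateLattice.2 fun N i _ => ?_⟩
  rw [← algebraMap_smul F, map_smul, Finsupp.smul_apply, algebraMap_smul]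
  by_cases h : b.repr v (g i) = 0
  · rw [h, smul_zero]
    exact Submodule.zero_mem _
  · obtain ⟨u, hu⟩ := hs _ (Finset.mem_image_of_mem _ (Finsupp.mem_support_iff.2 h))
    rw [← hu]
    exact algebraMap_mem_localSubmodule _ _

theorem repr_sum_smul_basis [FaithfulSMul S F] (hg : Function.Injective g) {m : ℕ} (c : Fin m → S)
    (j : Fin m) : b.repr (∑ j, c j • b (g j)) (g j) = algebraMap S F (c j) := by
  classical
  rw [map_sum, Finsupp.finsetSum_apply, Finset.sum_eq_single j]
  · rw [← algebraMap_smul F, map_smul]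
    simp [Algebra.smul_def]
  · intro k _ hk
    rw [← algebraMap_smul F, map_smul, b.repr_self, Finsupp.smul_apply,
      Finsupp.single_eq_of_ne, smul_zero]
    exact fun h => hk (Fin.ext (hg h).symm)
  · simp

theorem mem_of_sum_smul_basis_mem [FaithfulSMul S F] (hg : Function.Injective g)
    (N : MaximalSpectrum S) {m : ℕ} (hm : (m : ℕ∞) ≤ r N) (c : Fin m → S)
    (hc : ∑ j, c j • b (g j) ∈ N.asIdeal • coordinateLattice b g r) (j : Fin m) :
    c j ∈ N.asIdeal := by
  have hle : (coordinateLattice b g r).map ((b.coord (g j)).restrictScalars S) ≤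
      localSubmodule F N.asIdeal := by
    rintro _ ⟨v, hv, rfl⟩
    exact mem_coordinateLattice.1 hv N j (lt_of_lt_of_le (by exact_mod_cast j.2) hm)
  have h := Submodule.mem_map_of_mem (f := (b.coord (g j)).restrictScalars S) hc
  rw [Submodule.map_smul''] at h
  have h' := Submodule.smul_mono le_rfl hle h
  apply mem_of_algebraMap_mem_smul_localSubmodule (F := F)
  rw [← repr_sum_smul_basis (b := b) hg c j]
  exact h'

/-- Each restricted coordinate is congruent modulo `N` locally to some `c j ∈ S`, as `S` maps onto
the residue field of its localization. Unrestricted coordinates impose nothing at `N`. -/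
theorem exists_sub_sum_smul_basis_mem [IsDedekindDomain S] [IsFractionRing S F]
    (hS : ¬ IsField S) (hg : Function.Injective g) (N : MaximalSpectrum S) {m : ℕ} (hm : r N = m)
    {v : V} (hv : v ∈ coordinateLattice b g r) :
    ∃ c : Fin m → S, v - ∑ j, c j • b (g j) ∈ N.asIdeal • coordinateLattice b g r := by
  have hN := N.isMaximal
  -- For the zero derivation every element is constant, so `exists_uniformizer` supplies an ordinary
  -- local parameter.
  have hdense : HasDenseKernel (0 : Derivation ℤ S V) := fun s _ t => ⟨t, 0, rfl, by simp⟩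
  obtain ⟨a, t, -, -, ha0, haN, -, htN, hta⟩ := hdense.exists_uniformizer N.isMaximal
    (Ring.ne_bot_of_isMaximal_of_not_isField N.isMaximal hS)
  have ha : algebraMap S F a ≠ 0 := (IsFractionRing.to_map_eq_zero_iff (K := F)).not.2 ha0
  have hcoord : ∀ j : Fin m, ∃ c : S,
      (algebraMap S F t / algebraMap S F a) * (b.repr v (g j) - algebraMap S F c) ∈
        localSubmodule F N.asIdeal := by
    intro j
    obtain ⟨w, hw, u, hu⟩ := mem_coordinateLattice.1 hv N j (by rw [hm]; exact_mod_cast j.2)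
    obtain ⟨w', n, hn, hwn⟩ := hN.exists_inv hw
    obtain ⟨x, hx⟩ := hta n hn
    refine ⟨u * w', w, hw, u * x, ?_⟩
    rw [Algebra.smul_def] at hu ⊢
    have h1 := congrArg (algebraMap S F) hwn
    have h2 := congrArg (algebraMap S F) hx
    simp only [map_mul, map_add, map_one] at h1 h2 ⊢
    field_simp
    linear_combination algebraMap S F t * hu + algebraMap S F u * h2
      - algebraMap S F t * algebraMap S F u * h1
  choose c hc using hcoord
  refine ⟨c, ?_⟩
  set x := v - ∑ j, c j • b (g j) with hx
  have hxL : x ∈ coordinateLattice b g r := Submodule.sub_mem _ hv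
    (Submodule.sum_mem _ fun j _ => Submodule.smul_mem _ _ (basis_mem_coordinateLattice _))
  -- Division by `a` takes place only at `N`, where `c` was chosen for it; at other maximal ideals
  -- `t / a` is integral. Membership in `N L` then follows from `x = a (t / a) x + (1 - t) x`.
  have hy : (algebraMap S F t / algebraMap S F a) • x ∈ coordinateLattice b g r := by
    rw [mem_coordinateLattice]
    intro P i hi
    rw [map_smul, Finsupp.smul_apply, smul_eq_mul]
    by_cases hPN : P = N
    · subst hPN
      rw [hm] at hi
      have h := hc ⟨i, by exact_mod_cast hi⟩
      rw [hx, map_sub, Finsupp.sub_apply]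
      rw [← repr_sum_smul_basis (b := b) hg c ⟨i, by exact_mod_cast hi⟩] at h
      exact h
    · obtain ⟨n, hnN, hnP⟩ : ∃ n ∈ N.asIdeal, n ∉ P.asIdeal := by
        by_contra! hle
        exact hPN (MaximalSpectrum.ext (hN.eq_of_le P.isMaximal.ne_top hle).symm)
      obtain ⟨y, hy⟩ := hta n hnN
      refine mem_localSubmodule_of_smul_mem hnP ?_
      have h1 : n • (algebraMap S F t / algebraMap S F a * b.repr x (g i)) =
          y • b.repr x (g i) := by
        have h2 := congrArg (algebraMap S F) hy
        simp only [map_mul] at h2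
        rw [Algebra.smul_def, Algebra.smul_def]
        field_simp
        linear_combination b.repr x (g i) * h2
      rw [h1]
      exact Submodule.smul_mem _ _ (mem_coordinateLattice.1 hxL P i hi)
  have h3 : x = a • (algebraMap S F t / algebraMap S F a) • x + (1 - t) • x := by
    rw [← algebraMap_smul F a, smul_smul, mul_div_cancel₀ _ ha, algebraMap_smul]
    module
  rw [h3]
  exact Submodule.add_mem _ (Submodule.smul_mem_smul haN hy) (Submodule.smul_mem_smul htN hxL)

end Lattice

/-! ### Enumerating the maximal ideals and assembling the ring -/

theorem nonempty_subtype_lt_card_equiv (X : Type*) [Countable X] :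
    Nonempty ({n : ℕ // (n : ℕ∞) < ENat.card X} ≃ X) := by
  rcases finite_or_infinite X with hX | hX
  · refine ⟨(Equiv.subtypeEquivRight fun n => ?_).trans
      (Fin.equivSubtype.symm.trans (Finite.equivFin X).symm)⟩
    rw [ENat.card_eq_coe_natCard, Nat.cast_lt]
  · obtain ⟨h⟩ := nonempty_denumerable X
    refine ⟨(Equiv.subtypeUnivEquiv fun n => ?_).trans (Denumerable.eqv X).symm⟩
    rw [ENat.card_eq_top_of_infinite]
    exact ENat.natCast_lt_top n

theorem StronglyTwists.hasDenseKernel {S F K : Type*} [CommRing S] [IsDomain S] [Field F]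
    [Algebra S F] [IsFractionRing S F] [AddCommGroup K] [Module S K]
    {D : Derivation ℤ F (F ⊗[S] K)} {R : Subring S} (h : StronglyTwists D R) :
    HasDenseKernel (D.compAlgebraMap S) := by
  intro s hs t
  obtain ⟨x, hx, u, hu⟩ := h.exists_eq_add s hs t
  refine ⟨t - s * u, u, ?_, by ring⟩
  change D (algebraMap S F (t - s * u)) = 0
  rw [map_sub, hu, add_sub_cancel_right, hx]

theorem Derivation.span_range_compAlgebraMap {S F V : Type*} [CommRing S] [IsDomain S] [Field F]
    [Algebra S F] [IsFractionRing S F] [AddCommGroup V] [Module S V] [Module F V]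
    [IsScalarTower S F V] (D : Derivation ℤ F V) :
    Submodule.span F (Set.range (D.compAlgebraMap S)) = Submodule.span F (Set.range D) := by
  refine le_antisymm (Submodule.span_mono ?_) (Submodule.span_le.2 ?_)
  · rintro _ ⟨s, rfl⟩
    exact ⟨algebraMap S F s, rfl⟩
  · rintro _ ⟨x, rfl⟩
    obtain ⟨p, q, hq, rfl⟩ := IsFractionRing.div_surjective (A := S) x
    have hq0 : algebraMap S F q ≠ 0 :=
      (IsFractionRing.to_map_eq_zero_iff (K := F)).not.2 (nonZeroDivisors.ne_zero hq)
    have hmem : ∀ s : S, D (algebraMap S F s) ∈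
        Submodule.span F (Set.range (D.compAlgebraMap S)) := fun s =>
      Submodule.subset_span ⟨s, rfl⟩
    have h := D.leibniz (algebraMap S F q) (algebraMap S F p / algebraMap S F q)
    rw [mul_div_cancel₀ _ hq0] at h
    rw [SetLike.mem_coe, ← Submodule.smul_mem_iff _ hq0, ← sub_eq_of_eq_add h]
    exact Submodule.sub_mem _ (hmem p) (Submodule.smul_mem _ _ (hmem q))

theorem proposition7p3 {S F K : Type*} [CommRing S] [IsDedekindDomain S] (hS : ¬ IsField S)
    [Field F] [Algebra S F] [IsFractionRing S F]
    (hcount : Countable (MaximalSpectrum S))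
    [AddCommGroup K] [Module S K] (hK : Module.IsTorsionFree S K)
    (hrank : Cardinal.aleph0 ≤ Module.rank F (F ⊗[S] K))
    (htwist : ∃ R₀ : Subring S, IsStronglyTwistedBy F R₀ K)
    (e : ℕ → ℕ∞) (he : ∀ n, 1 ≤ e n) :
    ∃ (R : Subring S)
      (M : {n : ℕ // (n : ℕ∞) < ENat.card (MaximalSpectrum S)} ≃ MaximalSpectrum R),
      (IsStableDomain R ∧ IsFractionRing R F ∧ IsIntegralClosure S R F) ∧
      (∀ n, minGenerators (M n).asIdeal = e n + 1) ∧
      ((∀ n : {n : ℕ // (n : ℕ∞) < ENat.card (MaximalSpectrum S)}, e n ≠ ⊤) →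
        IsNoetherianRing R) := by
  obtain ⟨R₀, D, hD⟩ := htwist
  obtain ⟨σ⟩ := nonempty_subtype_lt_card_equiv (MaximalSpectrum S)
  let b := Module.Basis.ofVectorSpace F (F ⊗[S] K)
  have : Infinite (Module.Basis.ofVectorSpaceIndex F (F ⊗[S] K)) := by
    rwa [← Cardinal.aleph0_le_mk_iff, b.mk_eq_rank'']
  let g := Infinite.natEmbedding (Module.Basis.ofVectorSpaceIndex F (F ⊗[S] K))
  let r : MaximalSpectrum S → ℕ∞ := fun N => e (σ.symm N)
  let L := coordinateLattice b g r
  have : Module.IsTorsionFree S (F ⊗[S] K) := .trans_faithfulSMul S F _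
  have hd := hD.hasDenseKernel
  have hspan : Submodule.span F (Set.range (D.compAlgebraMap S)) = ⊤ :=
    D.span_range_compAlgebraMap.trans hD.span_eq_top
  have hL : ∀ v : F ⊗[S] K, ∃ s : S, s ≠ 0 ∧ s • v ∈ L := exists_smul_mem_coordinateLattice
  let M := σ.trans (hd.maximalSpectrumEquiv hS hL)
  have hgen : ∀ n, minGenerators (M n).asIdeal = e n + 1 := by
    intro n
    have hN := (σ n).isMaximal
    have hN0 := Ring.ne_bot_of_isMaximal_of_not_isField hN hS
    have hr : r (σ n) = e n := by simp [r]
    have hMn : (M n).asIdeal =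
      (σ n).asIdeal.comap (twistedSubring (D.compAlgebraMap S) L).subtype := rfl
    have hlow : ∀ m : ℕ, (m : ℕ∞) ≤ e n → (m : ℕ∞) + 1 ≤ minGenerators (M n).asIdeal := by
      intro m hm
      rw [hMn]
      exact hd.le_minGenerators_comap hspan hL hN hN0 (fun j : Fin m => b (g j))
        (fun j => basis_mem_coordinateLattice _)
        (mem_of_sum_smul_basis_mem g.injective (σ n) (hm.trans_eq hr.symm))
    rcases eq_or_ne (e n) ⊤ with htop | htop
    · rw [htop, top_add, ENat.eq_top_iff_forall_ge]
      -- When `e n` is infinite, the lower bound holds for every finite `m`, so no upper bound is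
      -- needed.
      exact fun m => le_self_add.trans (hlow m (htop ▸ le_top))
    · obtain ⟨m, hm⟩ := ENat.ne_top_iff_exists.1 htop
      refine le_antisymm ?_ (hm ▸ hlow m hm.le)
      -- The assumption `1 ≤ e n` provides the basis vector of index `0` into which the upper bound
      -- absorbs `1 - t`.
      obtain ⟨m, rfl⟩ : ∃ k, m = k + 1 := Nat.exists_eq_add_of_le' (by
        have := he n
        rw [← hm] at this
        exact_mod_cast this)
      rw [← hm, hMn]
      exact hd.minGenerators_comap_le hspan hL hN hN0 (fun j : Fin (m + 1) => b (g j))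
        (fun j => basis_mem_coordinateLattice _)
        fun v hv => exists_sub_sum_smul_basis_mem hS g.injective (σ n) (hr.trans hm.symm) hv
  refine ⟨twistedSubring (D.compAlgebraMap S) L, M,
    ⟨hd.isStableDomain F hL, hd.isFractionRing hL, hd.isIntegralClosure hL⟩, hgen, fun hfin => ?_⟩
  refine hd.isNoetherianRing hL fun P => fg_of_minGenerators_ne_top ?_
  obtain ⟨n, rfl⟩ := M.surjective P
  rw [hgen n]
  simpa using hfin n
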